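/- All digraphs are finite and simple (no loops, no multiple arcs). A digraph $G$ is strongly connected if for all vertices $u,v$ there is a directed path from $u$ to $v$. The vertex connectivity $\kappa(G)$ of a strongly connected digraph $G$ is the minimum number of vertices whose deletion yields a digraph that is not strongly connected or has at most one vertex (so $\kappa=n-1$ for the complete digraph on $n$ vertices). For $0\le\alpha<1$ let $A_\alpha(G)=\alpha D(G)+(1-\alpha)A(G)$, where $A(G)$ is the adjacency matrix ($a_{uv}=1$ if $(u,v)$ is an arc, and $0$ otherwise) and $D(G)$ is the diagonal matrix of outdegrees, and let $\lambda_\alpha(G)$ be the largest modulus of the eigenvalues of $A_\alpha(G)$. Let $\overset{\leftrightarrow}{K}_p$ denote the complete digraph on $p$ vertices, with all arcs $(u,v)$, $u\ne v$. For $1\le m\le n-k-1$ let $K(n,k,m)$ be the digraph obtained from the disjoint union of $\overset{\leftrightarrow}{K}_k$, $\overset{\leftrightarrow}{K}_{n-k-m}$ and $\overset{\leftrightarrow}{K}_m$ by adding all arcs in both directions between $\overset{\leftrightarrow}{K}_k$ and the other two parts, and all arcs $(u,v)$ with $u$ in $\overset{\leftrightarrow}{K}_m$ and $v$ in $\overset{\leftrightarrow}{K}_{n-k-m}$.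 Theorem. Let $n,k$ be integers with $1\le k\le n-2$, and let $G$ be a strongly connected digraph on $n$ vertices with vertex connectivity $\kappa(G)=k$. (i) For $\alpha=0$, $$\lambda_0(G)\le\frac{n-2+\sqrt{n^2-4n+4k+4}}{2},$$ with equality if and only if $G\cong K(n,k,n-k-1)$ or $G\cong K(n,k,1)$. (ii) For every $\alpha$ with $0<\alpha<1$, $$\lambda_\alpha(G)\le\lambda_\alpha(K(n,k,n-k-1))=\frac{n-2+\alpha+\alpha k+\sqrt{n^2+(2\alpha-4-2\alpha k)n+\alpha^2+\alpha^2k^2-4\alpha+2\alpha^2k-4\alpha k+4k+4}}{2},$$ with equality in the inequality if and only if $G\cong K(n,k,n-k-1)$. -/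

import Mathlib

namespace Digraph

/-- A simple digraph: no loops (multiple arcs are excluded by the type `Digraph`). -/
def IsSimple {V : Type*} (G : Digraph V) : Prop :=
  ∀ v : V, ¬ G.Adj v v

/-- Every vertex can be reached from every vertex along a directed path. -/
def StronglyConnected {V : Type*} (G : Digraph V) : Prop :=
  ∀ u v : V, Relation.ReflTransGen G.Adj u v

/-- The digraph `G - S` obtained by deleting the vertices in `S` and all arcs incident to them. -/
def deleteVertices {V : Type*} (G : Digraph V) (S : Finset V) : Digraph {v : V // v ∉ S} where
  Adj u v := G.Adj u v

/-- The vertex connectivity `κ(G)`: the minimum number of vertices whose deletion yields a digraph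
that is not strongly connected or has at most one vertex. The second alternative matters only for
complete digraphs, where it gives the usual value `κ = n - 1`: if there is no arc from `u` to `v`,
with `u ≠ v`, then deleting the other `n - 2` vertices already destroys strong connectivity. -/
noncomputable def vertexConnectivity {V : Type*} [Fintype V] (G : Digraph V) : ℕ :=
  sInf {c : ℕ | ∃ S : Finset V, S.card = c ∧
    (¬ (G.deleteVertices S).StronglyConnected ∨ Fintype.card V - S.card ≤ 1)}

/-- The outdegree `d⁺(u)`. -/
noncomputable def outDeg {V : Type*} (G : Digraph V) (u : V) : ℕ :=
  Set.ncard {v : V | G.Adj u v}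

open Classical in
/-- The adjacency matrix `A(G)`. -/
noncomputable def adjMat {V : Type*} (G : Digraph V) : Matrix V V ℝ :=
  Matrix.of fun u v => if G.Adj u v then 1 else 0

open Classical in
/-- The diagonal matrix `D(G)` of outdegrees. -/
noncomputable def outDegMat {V : Type*} (G : Digraph V) : Matrix V V ℝ :=
  Matrix.diagonal fun u => (G.outDeg u : ℝ)

/-- The matrix `A_α(G) = α D(G) + (1 - α) A(G)`. -/
noncomputable def alphaMat {V : Type*} (G : Digraph V) (α : ℝ) : Matrix V V ℝ :=
  α • G.outDegMat + (1 - α) • G.adjMat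

open Classical in
/-- The `A_α` spectral radius `λ_α(G)`: the largest modulus of the complex eigenvalues of
`A_α(G)`. -/
noncomputable def alphaSpectralRadius {V : Type*} [Fintype V] (G : Digraph V) (α : ℝ) : ℝ :=
  (spectralRadius ℂ ((G.alphaMat α).map (fun x : ℝ => (x : ℂ)))).toReal

/-- `G ≅ H`: there is a bijection of the vertices that preserves and reflects arcs. -/
def IsIsomorphic {V W : Type*} (G : Digraph V) (H : Digraph W) : Prop :=
  ∃ e : V ≃ W, ∀ u v : V, G.Adj u v ↔ H.Adj (e u) (e v)

/-- The complete (loopless) digraph on `p` vertices. -/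
def completeSimple (p : ℕ) : Digraph (Fin p) where
  Adj u v := u ≠ v

/-- The disjoint union `G₁ ∪ G₂`. -/
def disjointUnion {V W : Type*} (G : Digraph V) (H : Digraph W) : Digraph (V ⊕ W) where
  Adj x y := match x, y with
    | Sum.inl u, Sum.inl v => G.Adj u v
    | Sum.inr u, Sum.inr v => H.Adj u v
    | Sum.inl _, Sum.inr _ => False
    | Sum.inr _, Sum.inl _ => False

/-- The join `G₁ ∨ G₂`: the disjoint union, with all arcs in both directions between the parts. -/
def joinDigraph {V W : Type*} (G : Digraph V) (H : Digraph W) : Digraph (V ⊕ W) where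
  Adj x y := match x, y with
    | Sum.inl u, Sum.inl v => G.Adj u v
    | Sum.inr u, Sum.inr v => H.Adj u v
    | Sum.inl _, Sum.inr _ => True
    | Sum.inr _, Sum.inl _ => True

/-- The arc set `E`: all arcs from the third block (`K_m`) to the second block (`K_{n-k-m}`). -/
def extraArcs (k p m : ℕ) : Digraph (Fin k ⊕ (Fin p ⊕ Fin m)) where
  Adj x y := (∃ u : Fin m, x = Sum.inr (Sum.inr u)) ∧ (∃ v : Fin p, y = Sum.inr (Sum.inl v))

/-- The digraph `K(n, k, m) = (K_k ∨ (K_{n-k-m} ∪ K_m)) + E`, used for `k + m + 1 ≤ n`. -/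
def extremalK (n k m : ℕ) : Digraph (Fin k ⊕ (Fin (n - k - m) ⊕ Fin m)) :=
  (completeSimple k).joinDigraph ((completeSimple (n - k - m)).disjointUnion (completeSimple m)) ⊔
    extraArcs k (n - k - m) m

end Digraph

/-! Deleting a minimum separator S splits the other vertices into the set P reachable from one
vertex and a nonempty rest M, with no arc from P to M, so G lies inside `blockDigraph P M`. One
number L, `extremalValue`, bounds all these digraphs, whatever the sizes of P and M: a positive
vector x, constant on P and off P, satisfies the eigenvector equation for L on P and falls short of
it off P by (|P|-1)(α(n-1-L)+(1-α)(|M|-1)) ≥ 0 (`exists_blockDigraph_mulVec`). The Collatz–Wielandt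
bound `norm_eigenvalue_le_of_mulVec_le` then gives λ_α(G) ≤ L. In case of equality, strong
connectivity forces A_α(G) x = L x, so G has every arc of the block digraph and the defect vanishes:
|P| = 1, or α = 0 and |M| = 1. Conversely, when the defect is zero, x is an eigenvector of the block
digraph for L. Identifying block digraphs with K(n,k,|M|) turns these cases into the stated ones. -/

namespace Matrix

/-! ### Collatz–Wielandt bound and complex eigenvalues -/

open Relation

/-- If `A ≥ 0` and `A x ≤ r x` for a positive vector `x`, then every complex eigenvalue of `A` has
modulus at most `r`; if the value `r` is attained and `A` is irreducible, then `A x = r x`. -/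
theorem norm_eigenvalue_le_of_mulVec_le {V : Type*} [Fintype V] {A : Matrix V V ℝ}
    (hA : ∀ i j, 0 ≤ A i j) {x : V → ℝ} (hx : ∀ i, 0 < x i) {r : ℝ}
    (h : ∀ i, (A *ᵥ x) i ≤ r * x i) {μ : ℂ} {z : V → ℂ} (hz : z ≠ 0)
    (hμ : A.map (fun t : ℝ => (t : ℂ)) *ᵥ z = μ • z) :
    ‖μ‖ ≤ r ∧ (‖μ‖ = r → (∀ i j, ReflTransGen (fun i j => 0 < A i j) i j) →
      ∀ i, (A *ᵥ x) i = r * x i) := by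
  obtain ⟨i₀, hi₀⟩ := Function.ne_iff.mp hz
  -- With c the largest ratio |z_i|/x_i, one has |z| ≤ c x, tight at i; row i of |μ||z| ≤ A|z| ≤ c A
  -- x ≤ c r x gives the bound.
  obtain ⟨i, -, hi⟩ := Finset.exists_max_image Finset.univ (fun i => ‖z i‖ / x i)
    ⟨i₀, Finset.mem_univ _⟩
  set c := ‖z i‖ / x i with hc
  have hcx : ∀ j, ‖z j‖ ≤ c * x j := fun j => by
    have := hi j (Finset.mem_univ _)
    rwa [div_le_iff₀ (hx j)] at this
  have hc0 : 0 < c := lt_of_lt_of_le (div_pos (norm_pos_iff.mpr hi₀) (hx i₀))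
    (hi i₀ (Finset.mem_univ _))
  have hnorm : ∀ j, ‖μ‖ * ‖z j‖ ≤ ∑ l, A j l * ‖z l‖ := fun j => by
    have h1 := congrFun hμ j
    simp only [mulVec, dotProduct, map_apply, Pi.smul_apply, smul_eq_mul] at h1
    rw [← norm_mul, ← h1]
    refine (norm_sum_le _ _).trans (Finset.sum_le_sum fun l _ => ?_)
    rw [norm_mul, Complex.norm_real, Real.norm_of_nonneg (hA j l)]
  have hsum : ∀ j, ∑ l, A j l * ‖z l‖ ≤ c * (A *ᵥ x) j := fun j => by
    simp only [mulVec, dotProduct, Finset.mul_sum]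
    refine Finset.sum_le_sum fun l _ => ?_
    nlinarith [mul_le_mul_of_nonneg_left (hcx l) (hA j l)]
  refine ⟨?_, fun hr hirr => ?_⟩
  · have hzi : ‖z i‖ = c * x i := by rw [hc, div_mul_cancel₀ _ (hx i).ne']
    have h1 := (hnorm i).trans ((hsum i).trans (mul_le_mul_of_nonneg_left (h i) hc0.le))
    rw [hzi] at h1
    have hpos : 0 < c * x i := mul_pos hc0 (hx i)
    nlinarith
  -- In a row where |z_j| = c x_j the whole chain collapses, term by term, so tightness spreads
  -- along positive entries and, by irreducibility, from i to every index.
  · have tight : ∀ j, ‖z j‖ = c * x j →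
        (A *ᵥ x) j = r * x j ∧ ∀ l, 0 < A j l → ‖z l‖ = c * x l := fun j hj => by
      have h1 := hnorm j
      rw [hr, hj] at h1
      have h2 := hsum j
      have h3 : c * (A *ᵥ x) j ≤ c * (r * x j) := mul_le_mul_of_nonneg_left (h j) hc0.le
      have h4 : c * (A *ᵥ x) j = c * (r * x j) := by nlinarith
      refine ⟨mul_left_cancel₀ hc0.ne' h4, fun l hl => ?_⟩
      have h5 : ∑ l, A j l * ‖z l‖ = ∑ l, A j l * (c * x l) := by
        have : ∑ l, A j l * (c * x l) = c * (A *ᵥ x) j := by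
          simp only [mulVec, dotProduct, Finset.mul_sum]
          exact Finset.sum_congr rfl fun l _ => by ring
        rw [this]
        nlinarith
      have h6 := (Finset.sum_eq_sum_iff_of_le fun l _ =>
        mul_le_mul_of_nonneg_left (hcx l) (hA j l)).mp h5 l (Finset.mem_univ _)
      exact mul_left_cancel₀ hl.ne' h6
    have all : ∀ j, ‖z j‖ = c * x j := fun j => by
      induction hirr i j with
      | refl => rw [hc, div_mul_cancel₀ _ (hx i).ne']
      | tail _ hbc ih => exact (tight _ ih).2 _ hbc
    exact fun j => (tight j (all j)).1

theorem mem_spectrum_iff_exists_mulVec {V : Type*} [Fintype V] [DecidableEq V]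
    {A : Matrix V V ℂ} {μ : ℂ} : μ ∈ spectrum ℂ A ↔ ∃ z : V → ℂ, z ≠ 0 ∧ A *ᵥ z = μ • z := by
  rw [← Matrix.spectrum_toLin', ← Module.End.hasEigenvalue_iff_mem_spectrum]
  constructor
  · intro h
    obtain ⟨z, hz⟩ := h.exists_hasEigenvector
    exact ⟨z, hz.2, by simpa using hz.apply_eq_smul⟩
  · rintro ⟨z, hz, h⟩
    exact Module.End.hasEigenvalue_of_hasEigenvector (x := z)
      ⟨Module.End.mem_eigenspace_iff.mpr (by simpa using h), hz⟩

section

attribute [local instance] Matrix.linftyOpNormedRing Matrix.linftyOpNormedAlgebra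

/-- The spectrum is compact and nonempty in a complex Banach algebra; the norm only supplies that
structure, since `spectralRadius` depends on the spectrum alone. -/
theorem exists_norm_eq_spectralRadius {V : Type*} [Fintype V] [DecidableEq V] [Nonempty V]
    (A : Matrix V V ℂ) :
    ∃ μ ∈ spectrum ℂ A, spectralRadius ℂ A = (‖μ‖₊ : ENNReal) := by
  obtain ⟨μ, hμ, h⟩ := spectrum.exists_nnnorm_eq_spectralRadius A
  exact ⟨μ, hμ, h.symm⟩

end

end Matrix

namespace Digraph

/-! ### Spectral radius and weighted row sums of A_α -/

open Matrix

variable {V : Type*}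

/-- `λ_α(G)` is the modulus of an eigenvalue. -/
theorem exists_eigenvector_norm_eq_alphaSpectralRadius [Fintype V] [Nonempty V] (G : Digraph V)
    (α : ℝ) : ∃ (μ : ℂ) (z : V → ℂ), z ≠ 0 ∧
      (G.alphaMat α).map (fun t : ℝ => (t : ℂ)) *ᵥ z = μ • z ∧
      ‖μ‖ = G.alphaSpectralRadius α := by
  classical
  obtain ⟨μ, hμ, h⟩ :=
    exists_norm_eq_spectralRadius ((G.alphaMat α).map (fun t : ℝ => (t : ℂ)))
  obtain ⟨z, hz, hz'⟩ := mem_spectrum_iff_exists_mulVec.mp hμ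
  refine ⟨μ, z, hz, hz', ?_⟩
  have h' : (spectralRadius ℂ ((G.alphaMat α).map (fun t : ℝ => (t : ℂ)))).toReal = ‖μ‖ := by
    rw [h]; simp
  rw [← h']
  unfold alphaSpectralRadius
  convert rfl

/-- Real eigenvalues with real eigenvectors are at most `λ_α(G)`. -/
theorem le_alphaSpectralRadius [Fintype V] (G : Digraph V) {α r : ℝ} {x : V → ℝ} (hx : x ≠ 0)
    (h : G.alphaMat α *ᵥ x = r • x) : r ≤ G.alphaSpectralRadius α := by
  classical
  obtain ⟨i, hi⟩ := Function.ne_iff.mp hx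
  have : Nonempty V := ⟨i⟩
  set B := (G.alphaMat α).map (fun t : ℝ => (t : ℂ)) with hB
  have hmem : (r : ℂ) ∈ spectrum ℂ B := by
    refine mem_spectrum_iff_exists_mulVec.mpr ⟨fun j => (x j : ℂ), fun h0 => hi ?_, ?_⟩
    · simpa using congrFun h0 i
    · funext j
      have := congrArg (fun t : ℝ => (t : ℂ)) (congrFun h j)
      simpa [hB, mulVec, dotProduct] using this
  obtain ⟨μ, -, hμ⟩ := exists_norm_eq_spectralRadius B
  have h1 : (‖(r : ℂ)‖₊ : ENNReal) ≤ spectralRadius ℂ B :=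
    le_iSup₂ (f := fun (k : ℂ) (_ : k ∈ spectrum ℂ B) => (‖k‖₊ : ENNReal)) _ hmem
  have h2 := ENNReal.toReal_mono (by rw [hμ]; exact ENNReal.coe_ne_top) h1
  have h3 : r ≤ (spectralRadius ℂ B).toReal := by
    refine le_trans ?_ h2
    simpa using le_abs_self r
  unfold alphaSpectralRadius
  convert h3

open Classical in
theorem alphaMat_mulVec [Fintype V] (G : Digraph V) (α : ℝ) (x : V → ℝ) (u : V) :
    (G.alphaMat α *ᵥ x) u = ∑ v, if G.Adj u v then α * x u + (1 - α) * x v else 0 := by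
  have hdeg : (G.outDeg u : ℝ) = ∑ v, if G.Adj u v then 1 else 0 := by
    rw [outDeg, Set.ncard_eq_toFinset_card']
    simp
  have : G.alphaMat α *ᵥ x = α • (G.outDegMat *ᵥ x) + (1 - α) • (G.adjMat *ᵥ x) := by
    rw [alphaMat, add_mulVec, smul_mulVec, smul_mulVec]
  rw [this]
  simp only [Pi.add_apply, Pi.smul_apply, smul_eq_mul, outDegMat, mulVec_diagonal, adjMat, hdeg]
  simp only [mulVec, dotProduct, of_apply, Finset.sum_mul, Finset.mul_sum,
    ← Finset.sum_add_distrib]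
  exact Finset.sum_congr rfl fun v _ => by split_ifs <;> ring

theorem alphaMat_nonneg (G : Digraph V) {α : ℝ} (h0 : 0 ≤ α) (h1 : α ≤ 1) (u v : V) :
    0 ≤ G.alphaMat α u v := by
  classical
  have h2 : 0 ≤ 1 - α := by linarith
  simp only [alphaMat, outDegMat, adjMat, Matrix.add_apply, Matrix.smul_apply, diagonal_apply, of_apply,
    smul_eq_mul]
  split_ifs <;> positivity

theorem alphaMat_pos_of_adj (G : Digraph V) {α : ℝ} (h0 : 0 ≤ α) (h1 : α < 1) {u v : V}
    (h : G.Adj u v) : 0 < G.alphaMat α u v := by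
  classical
  have h2 : 0 < 1 - α := by linarith
  simp only [alphaMat, outDegMat, adjMat, Matrix.add_apply, Matrix.smul_apply, diagonal_apply, of_apply,
    smul_eq_mul, h, if_true]
  split_ifs <;> positivity

/-! ### Block digraphs, two-valued vectors and the extremal value -/

/-- The digraph with all arcs except those from `P` to `M`. -/
def blockDigraph (P M : Finset V) : Digraph V where
  Adj u v := u ≠ v ∧ ¬ (u ∈ P ∧ v ∈ M)

open Classical in
/-- The vector with value `b` on `P` and `a` off `P`. -/
noncomputable def blockVec (P : Finset V) (a b : ℝ) (v : V) : ℝ := if v ∈ P then b else a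

theorem blockVec_pos (P : Finset V) {a b : ℝ} (ha : 0 < a) (hb : 0 < b) (v : V) :
    0 < blockVec P a b v := by
  unfold blockVec; split_ifs <;> assumption

open Classical in
theorem sum_blockVec (P T : Finset V) (hPT : P ⊆ T) (a b : ℝ) :
    ∑ v ∈ T, blockVec P a b v = P.card * b + ((T.card : ℝ) - P.card) * a := by
  simp only [blockVec, Finset.sum_ite, Finset.sum_const, nsmul_eq_mul, Finset.filter_mem_eq_inter,
    Finset.inter_eq_right.mpr hPT]
  rw [Finset.filter_not, Finset.filter_mem_eq_inter, Finset.inter_eq_right.mpr hPT,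
    Finset.card_sdiff_of_subset hPT, Nat.cast_sub (Finset.card_le_card hPT)]

open Classical in
theorem alphaMat_blockDigraph_mulVec_of_notMem [Fintype V] {P M : Finset V} (α a b : ℝ) {u : V}
    (hu : u ∉ P) :
    ((blockDigraph P M).alphaMat α *ᵥ blockVec P a b) u =
      ((Fintype.card V : ℝ) - 1 - (1 - α) * P.card) * a + (1 - α) * P.card * b := by
  rw [alphaMat_mulVec]
  have h1 : ∀ v, (blockDigraph P M).Adj u v ↔ v ∈ Finset.univ.erase u := fun v => by
    simp [blockDigraph, hu, eq_comm]
  simp only [h1]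
  rw [Finset.sum_ite_mem, Finset.univ_inter, Finset.sum_erase_eq_sub (Finset.mem_univ u),
    Finset.sum_add_distrib, ← Finset.mul_sum (f := blockVec P a b), sum_blockVec P _ (Finset.subset_univ _)]
  simp only [blockVec, hu, if_false, Finset.sum_const, nsmul_eq_mul, Finset.card_univ]
  ring

open Classical in
theorem alphaMat_blockDigraph_mulVec_of_mem [Fintype V] {P M : Finset V} (hPM : Disjoint P M)
    (α a b : ℝ) {u : V} (hu : u ∈ P) :
    ((blockDigraph P M).alphaMat α *ᵥ blockVec P a b) u =
      (1 - α) * ((Fintype.card V : ℝ) - M.card - P.card) * a +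
        (P.card - 1 + α * ((Fintype.card V : ℝ) - M.card - P.card)) * b := by
  rw [alphaMat_mulVec]
  have h1 : ∀ v, (blockDigraph P M).Adj u v ↔ v ∈ Mᶜ.erase u := fun v => by
    simp [blockDigraph, hu, eq_comm]
  have h2 : P ⊆ Mᶜ := fun v hv => by simpa using Finset.disjoint_left.mp hPM hv
  simp only [h1]
  rw [Finset.sum_ite_mem, Finset.univ_inter, Finset.sum_erase_eq_sub (h2 hu),
    Finset.sum_add_distrib, ← Finset.mul_sum (f := blockVec P a b), sum_blockVec P _ h2]
  simp only [blockVec, hu, if_true, Finset.sum_const, nsmul_eq_mul]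
  rw [Finset.card_compl, Nat.cast_sub (Finset.card_le_univ M)]
  ring

/-- The row sums of `A_α` weighted by a positive vector grow with the digraph, and two such row sums
of a digraph and a subdigraph agree only if the outgoing arcs do. -/
theorem alphaMat_mulVec_le_of_le [Fintype V] {G H : Digraph V}
    (hGH : ∀ u v, G.Adj u v → H.Adj u v) {α : ℝ} (h0 : 0 ≤ α) (h1 : α < 1) {x : V → ℝ}
    (hx : ∀ v, 0 < x v) (u : V) :
    (G.alphaMat α *ᵥ x) u ≤ (H.alphaMat α *ᵥ x) u ∧
      ((G.alphaMat α *ᵥ x) u = (H.alphaMat α *ᵥ x) u → ∀ v, H.Adj u v → G.Adj u v) := by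
  classical
  have h2 : 0 < 1 - α := by linarith
  have hpos : ∀ v, 0 < α * x u + (1 - α) * x v := fun v =>
    add_pos_of_nonneg_of_pos (mul_nonneg h0 (hx u).le) (mul_pos h2 (hx v))
  have hle : ∀ v ∈ Finset.univ, (if G.Adj u v then α * x u + (1 - α) * x v else 0) ≤
      if H.Adj u v then α * x u + (1 - α) * x v else 0 := fun v _ => by
    by_cases hG : G.Adj u v
    · simp [hG, hGH u v hG]
    · rw [if_neg hG]
      split_ifs
      exacts [(hpos v).le, le_rfl]
  rw [alphaMat_mulVec, alphaMat_mulVec]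
  refine ⟨Finset.sum_le_sum hle, fun heq v hH => ?_⟩
  have := (Finset.sum_eq_sum_iff_of_le hle).mp heq v (Finset.mem_univ _)
  by_contra hG
  rw [if_neg hG, if_pos hH] at this
  exact (hpos v).ne this

/-- The claimed value of `λ_α(K(n, k, n - k - 1))`, for real `n` and `k`. -/
noncomputable def extremalValue (n k α : ℝ) : ℝ :=
  (n - 2 + α + α * k + Real.sqrt (n ^ 2 + (2 * α - 4 - 2 * α * k) * n + α ^ 2 + α ^ 2 * k ^ 2
    - 4 * α + 2 * α ^ 2 * k - 4 * α * k + 4 * k + 4)) / 2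

/-- The quadratic is the characteristic equation of the quotient matrix with rows (n-2+α, 1-α) and
((1-α)k, αk), which belongs to a block digraph with |P| = 1. The lower bound makes the test vector
positive; the upper one gives the defect its sign. -/
theorem extremalValue_spec {n k α : ℝ} (hk : 0 < k) (hkn : k + 1 < n) (h1 : α < 1) :
    (extremalValue n k α - (n - 2 + α)) * (extremalValue n k α - α * k) = (1 - α) ^ 2 * k ∧
      n - 2 + α < extremalValue n k α ∧ extremalValue n k α < n - 1 := by
  have hd : n ^ 2 + (2 * α - 4 - 2 * α * k) * n + α ^ 2 + α ^ 2 * k ^ 2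
      - 4 * α + 2 * α ^ 2 * k - 4 * α * k + 4 * k + 4 =
      (n - 2 + α - α * k) ^ 2 + 4 * ((1 - α) ^ 2 * k) := by ring
  have h2 : 0 < 1 - α := by linarith
  have hpos : 0 < (1 - α) ^ 2 * k := by positivity
  have hαk : α * k ≤ k := by nlinarith
  unfold extremalValue
  rw [hd]
  set D := (n - 2 + α - α * k) ^ 2 + 4 * ((1 - α) ^ 2 * k) with hD
  have hsq : Real.sqrt D ^ 2 = D := Real.sq_sqrt (by positivity)
  have hlow : n - 2 + α - α * k < Real.sqrt D := by
    refine Real.lt_sqrt_of_sq_lt ?_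
    rw [hD]; linarith
  have hup : Real.sqrt D < n - α - α * k := by
    rw [Real.sqrt_lt' (by linarith)]
    have : (n - α - α * k) ^ 2 - D = 4 * ((1 - α) * (n - 1 - k)) := by rw [hD]; ring
    have : 0 < (1 - α) * (n - 1 - k) := mul_pos h2 (by linarith)
    linarith
  refine ⟨?_, by linarith, by linarith⟩
  have : ∀ s : ℝ, ((n - 2 + α + α * k + s) / 2 - (n - 2 + α)) *
      ((n - 2 + α + α * k + s) / 2 - α * k) = (s ^ 2 - (n - 2 + α - α * k) ^ 2) / 4 := by
    intro s; ring
  rw [this, hsq, hD]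
  ring

/-! ### The sharp bound for subdigraphs of a block digraph -/

section Block

variable [Fintype V] {P M : Finset V} {n k : ℕ} {α : ℝ}

/-- The test vector: the eigenvector equation of the block digraph holds on `P`, and off `P` it holds
up to a defect with an explicit sign. -/
theorem exists_blockDigraph_mulVec (hPM : Disjoint P M) (hP : P.Nonempty) (hM : M.Nonempty)
    (hn : Fintype.card V = n) (hk : P.card + M.card + k = n) (hk0 : 1 ≤ k)
    (h0 : 0 ≤ α) (h1 : α < 1) :
    ∃ x : V → ℝ, (∀ v, 0 < x v) ∧
      (∀ u ∈ P, ((blockDigraph P M).alphaMat α *ᵥ x) u = extremalValue n k α * x u) ∧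
      ∀ u ∉ P, ((blockDigraph P M).alphaMat α *ᵥ x) u = extremalValue n k α * x u -
        ((P.card : ℝ) - 1) *
          (α * ((n : ℝ) - 1 - extremalValue n k α) + (1 - α) * ((M.card : ℝ) - 1)) := by
  have hp : (1 : ℝ) ≤ P.card := by exact_mod_cast hP.card_pos
  have hm : (1 : ℝ) ≤ M.card := by exact_mod_cast hM.card_pos
  have hk0' : (1 : ℝ) ≤ k := by exact_mod_cast hk0
  have hkr : (P.card : ℝ) + M.card + k = n := by exact_mod_cast hk
  obtain ⟨hL, hL1, hL2⟩ := extremalValue_spec (n := n) (k := k) (α := α) (by linarith)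
    (by linarith) h1
  set L := extremalValue n k α
  have h2 : 0 < 1 - α := by linarith
  -- Here n - 2 + α ≥ |P| - 1 + k + α, because |M| ≥ 1.
  have ha : 0 < L - (P.card - 1 + α * k) := by nlinarith
  have hb : 0 < (1 - α) * (k : ℝ) := by positivity
  -- The ratio of the two values is the one that solves the equation of the rows in P; off P the
  -- quadratic for L then reduces the remainder to the defect.
  refine ⟨blockVec P (L - (P.card - 1 + α * k)) ((1 - α) * k), blockVec_pos P ha hb, ?_, ?_⟩
  · intro u hu
    rw [alphaMat_blockDigraph_mulVec_of_mem hPM _ _ _ hu, hn]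
    simp only [blockVec, hu, if_true]
    rw [← hkr]; ring
  · intro u hu
    rw [alphaMat_blockDigraph_mulVec_of_notMem _ _ _ hu, hn]
    simp only [blockVec, hu, if_false]
    have : (M.card : ℝ) = n - k - P.card := by linarith
    rw [this]
    linear_combination -hL

theorem alphaSpectralRadius_le_extremalValue {G : Digraph V} (hconn : G.StronglyConnected)
    (hG : ∀ u v, G.Adj u v → (blockDigraph P M).Adj u v)
    (hPM : Disjoint P M) (hP : P.Nonempty) (hM : M.Nonempty)
    (hn : Fintype.card V = n) (hk : P.card + M.card + k = n) (hk0 : 1 ≤ k)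
    (h0 : 0 ≤ α) (h1 : α < 1) :
    G.alphaSpectralRadius α ≤ extremalValue n k α ∧
      (G.alphaSpectralRadius α = extremalValue n k α → G = blockDigraph P M ∧
        (P.card = 1 ∨ α = 0 ∧ M.card = 1)) := by
  have : Nonempty V := hP.to_type
  obtain ⟨x, hx, hxP, hxP'⟩ := exists_blockDigraph_mulVec hPM hP hM hn hk hk0 h0 h1
  have hp : (1 : ℝ) ≤ P.card := by exact_mod_cast hP.card_pos
  have hm : (1 : ℝ) ≤ M.card := by exact_mod_cast hM.card_pos
  have hk0' : (1 : ℝ) ≤ k := by exact_mod_cast hk0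
  have hkr : (P.card : ℝ) + M.card + k = n := by exact_mod_cast hk
  obtain ⟨-, -, hL⟩ := extremalValue_spec (n := n) (k := k) (α := α) (by linarith)
    (by linarith) h1
  set L := extremalValue n k α
  have hdef1 : 0 ≤ α * ((n : ℝ) - 1 - L) := mul_nonneg h0 (by linarith)
  have hdef2 : 0 ≤ (1 - α) * ((M.card : ℝ) - 1) := mul_nonneg (by linarith) (by linarith)
  have hdef : 0 ≤ ((P.card : ℝ) - 1) *
      (α * ((n : ℝ) - 1 - L) + (1 - α) * ((M.card : ℝ) - 1)) :=
    mul_nonneg (by linarith) (by linarith)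
  have hK : ∀ u, ((blockDigraph P M).alphaMat α *ᵥ x) u ≤ L * x u := fun u => by
    by_cases hu : u ∈ P
    · exact (hxP u hu).le
    · rw [hxP' u hu]; linarith
  obtain ⟨μ, z, hz, hμ, hr⟩ := G.exists_eigenvector_norm_eq_alphaSpectralRadius α
  have hmono := alphaMat_mulVec_le_of_le hG h0 h1 hx
  obtain ⟨hle, heq⟩ := norm_eigenvalue_le_of_mulVec_le (G.alphaMat_nonneg h0 h1.le) hx
    (fun u => (hmono u).1.trans (hK u)) hz hμ
  rw [hr] at hle heq
  refine ⟨hle, fun h => ?_⟩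
  have hxG := heq h fun i j => Relation.ReflTransGen.mono (fun _ _ => G.alphaMat_pos_of_adj h0 h1) _ _ (hconn i j)
  constructor
  · refine Digraph.ext (funext fun u => funext fun v => propext ⟨hG u v, ?_⟩)
    exact (hmono u).2 (le_antisymm (hmono u).1 ((hK u).trans (hxG u).ge)) v
  -- A row off P is needed to read off the defect; any vertex of M provides one.
  · obtain ⟨w, hw⟩ := hM
    have hwP : w ∉ P := Finset.disjoint_right.mp hPM hw
    have hz0 : ((P.card : ℝ) - 1) *
        (α * ((n : ℝ) - 1 - L) + (1 - α) * ((M.card : ℝ) - 1)) = 0 := by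
      have h3 := (hmono w).1
      rw [hxG w, hxP' w hwP] at h3
      linarith
    rcases mul_eq_zero.mp hz0 with h3 | h3
    · left; exact_mod_cast (by linarith : (P.card : ℝ) = 1)
    · right
      -- Both summands are nonnegative, and L < n - 1 strictly, so α must vanish.
      have h4 : α = 0 := by
        have h5 : α * ((n : ℝ) - 1 - L) = 0 := by linarith
        rcases mul_eq_zero.mp h5 with h6 | h6
        · exact h6
        · linarith
      refine ⟨h4, ?_⟩
      rw [h4] at h3
      exact_mod_cast (by linarith : (M.card : ℝ) = 1)

theorem extremalValue_le_alphaSpectralRadius_blockDigraph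
    (hPM : Disjoint P M) (hP : P.Nonempty) (hM : M.Nonempty)
    (hn : Fintype.card V = n) (hk : P.card + M.card + k = n) (hk0 : 1 ≤ k)
    (h0 : 0 ≤ α) (h1 : α < 1) (h : P.card = 1 ∨ α = 0 ∧ M.card = 1) :
    extremalValue n k α ≤ (blockDigraph P M).alphaSpectralRadius α := by
  obtain ⟨x, hx, hxP, hxP'⟩ := exists_blockDigraph_mulVec hPM hP hM hn hk hk0 h0 h1
  obtain ⟨w, -⟩ := hP
  refine le_alphaSpectralRadius _ (x := x) (fun h' => (hx w).ne' (congrFun h' w)) ?_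
  funext u
  rw [Pi.smul_apply, smul_eq_mul]
  by_cases hu : u ∈ P
  · exact hxP u hu
  · rw [hxP' u hu]
    rcases h with h | ⟨h, h'⟩
    · simp [h]
    · simp [h, h']

/-- A vertex outside P ∪ M has arcs to and from every other vertex. -/
theorem blockDigraph_stronglyConnected (hPM : Disjoint P M)
    (h : P.card + M.card < Fintype.card V) : (blockDigraph P M).StronglyConnected := by
  classical
  obtain ⟨s, hs⟩ : ∃ s, s ∉ P ∪ M := by
    by_contra! hall
    have h1 : P ∪ M = Finset.univ := Finset.eq_univ_iff_forall.mpr hall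
    rw [← Finset.card_union_of_disjoint hPM, h1, Finset.card_univ] at h
    exact lt_irrefl _ h
  rw [Finset.mem_union, not_or] at hs
  intro u v
  refine Relation.ReflTransGen.trans (b := s) ?_ ?_
  · by_cases hus : u = s
    · rw [hus]
    · exact .single ⟨hus, fun h => hs.2 h.2⟩
  · by_cases hsv : s = v
    · rw [hsv]
    · exact .single ⟨hsv, fun h => hs.1 h.1⟩

theorem alphaSpectralRadius_blockDigraph
    (hPM : Disjoint P M) (hP : P.Nonempty) (hM : M.Nonempty)
    (hn : Fintype.card V = n) (hk : P.card + M.card + k = n) (hk0 : 1 ≤ k)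
    (h0 : 0 ≤ α) (h1 : α < 1) (h : P.card = 1 ∨ α = 0 ∧ M.card = 1) :
    (blockDigraph P M).alphaSpectralRadius α = extremalValue n k α :=
  le_antisymm (alphaSpectralRadius_le_extremalValue
    (blockDigraph_stronglyConnected hPM (by omega)) (fun _ _ => id) hPM hP hM hn hk hk0 h0 h1).1
    (extremalValue_le_alphaSpectralRadius_blockDigraph hPM hP hM hn hk hk0 h0 h1 h)

end Block

/-! ### Block digraphs versus K(n,k,m) -/

theorem exists_eq_blockDigraph_of_isIsomorphic [Fintype V] {G : Digraph V} {n k m : ℕ}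
    (h : G.IsIsomorphic (extremalK n k m)) (hm : k + m ≤ n) :
    ∃ P M : Finset V, Disjoint P M ∧ P.card = n - k - m ∧ M.card = m ∧ Fintype.card V = n ∧
      G = blockDigraph P M := by
  classical
  obtain ⟨e, he⟩ := h
  refine ⟨Finset.univ.map ((Function.Embedding.inl.trans Function.Embedding.inr).trans
      e.symm.toEmbedding),
    Finset.univ.map ((Function.Embedding.inr.trans Function.Embedding.inr).trans
      e.symm.toEmbedding), ?_, by simp, by simp, ?_, ?_⟩
  · rw [Finset.disjoint_left]
    simp
  · rw [Fintype.card_congr e]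
    simp only [Fintype.card_sum, Fintype.card_fin]
    omega
  · refine Digraph.ext (funext fun u => funext fun v => propext ?_)
    obtain ⟨a, rfl⟩ := e.symm.surjective u
    obtain ⟨b, rfl⟩ := e.symm.surjective v
    rw [he]
    rcases a with a | a | a <;> rcases b with b | b | b <;>
      simp [extremalK, joinDigraph, disjointUnion, completeSimple, extraArcs, blockDigraph]

theorem blockDigraph_isIsomorphic_extremalK [Fintype V] {P M : Finset V} {n k m : ℕ}
    (hPM : Disjoint P M) (hn : Fintype.card V = n) (hk : P.card + M.card + k = n)
    (hm : M.card = m) : (blockDigraph P M).IsIsomorphic (extremalK n k m) := by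
  classical
  have hP : P.card = n - k - m := by omega
  have hS : (P ∪ M)ᶜ.card = k := by
    rw [Finset.card_compl, Finset.card_union_of_disjoint hPM]; omega
  let eP := P.equivFinOfCardEq hP
  let eM := M.equivFinOfCardEq hm
  let eS := (P ∪ M)ᶜ.equivFinOfCardEq hS
  let f : Fin k ⊕ (Fin (n - k - m) ⊕ Fin m) → V :=
    Sum.elim (fun i => eS.symm i) (Sum.elim (fun i => eP.symm i) (fun i => eM.symm i))
  have hfS : ∀ i, ((eS.symm i : _) : V) ∉ P ∧ ((eS.symm i : _) : V) ∉ M := fun i => by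
    have := (eS.symm i).2
    rwa [Finset.mem_compl, Finset.mem_union, not_or] at this
  have hfP : ∀ i, ((eP.symm i : _) : V) ∈ P := fun i => (eP.symm i).2
  have hfM : ∀ i, ((eM.symm i : _) : V) ∈ M := fun i => (eM.symm i).2
  have hfP' : ∀ i, ((eP.symm i : _) : V) ∉ M := fun i => Finset.disjoint_left.mp hPM (hfP i)
  have hfM' : ∀ i, ((eM.symm i : _) : V) ∉ P := fun i => Finset.disjoint_right.mp hPM (hfM i)
  have hinj : Function.Injective f := by
    have hne : ∀ {p q : V} {T : Finset V}, p ∈ T → q ∉ T → p ≠ q := fun h1 h2 h3 => h2 (h3 ▸ h1)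
    refine Function.Injective.sumElim (Subtype.val_injective.comp eS.symm.injective)
      (Function.Injective.sumElim (Subtype.val_injective.comp eP.symm.injective)
        (Subtype.val_injective.comp eM.symm.injective) fun i j => hne (hfP i) (hfM' j)) ?_
    rintro i (j | j)
    · exact (hne (hfP j) (hfS i).1).symm
    · exact (hne (hfM j) (hfS i).2).symm
  have hbij : Function.Bijective f := by
    refine (Fintype.bijective_iff_injective_and_card f).mpr ⟨hinj, ?_⟩
    simp only [Fintype.card_sum, Fintype.card_fin]
    omega
  let e := Equiv.ofBijective f hbij
  refine ⟨e.symm, fun u v => ?_⟩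
  obtain ⟨a, rfl⟩ := e.surjective u
  obtain ⟨b, rfl⟩ := e.surjective v
  have hne : e a ≠ e b ↔ a ≠ b := e.injective.ne_iff
  rw [Equiv.symm_apply_apply, Equiv.symm_apply_apply]
  simp only [blockDigraph, hne]
  rcases a with a | a | a <;> rcases b with b | b | b <;>
    simp [e, f, hfS, hfP, hfM, hfP', hfM', extremalK, joinDigraph, disjointUnion, completeSimple,
      extraArcs]

/-! ### From vertex connectivity to a block digraph -/

/-- A digraph with a separating set of `k` vertices is a subdigraph of a block digraph. -/
theorem exists_blockDigraph_of_not_stronglyConnected [Fintype V] {G : Digraph V}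
    (hsimple : G.IsSimple) {S : Finset V} (hS : ¬ (G.deleteVertices S).StronglyConnected) :
    ∃ P M : Finset V, Disjoint P M ∧ P.Nonempty ∧ M.Nonempty ∧
      P.card + M.card + S.card = Fintype.card V ∧
      ∀ u v, G.Adj u v → (blockDigraph P M).Adj u v := by
  classical
  simp only [StronglyConnected, not_forall] at hS
  obtain ⟨a, b, hab⟩ := hS
  -- The set reachable from a in G - S is closed under arcs of G - S, so no arc of G joins it to the
  -- complement of P ∪ S.
  let P : Finset V := Finset.univ.filter fun w =>
    ∃ h : w ∉ S, Relation.ReflTransGen (G.deleteVertices S).Adj a ⟨w, h⟩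
  have hmemP : ∀ w, w ∈ P ↔ ∃ h : w ∉ S,
      Relation.ReflTransGen (G.deleteVertices S).Adj a ⟨w, h⟩ := fun w => by simp [P]
  have hPS : Disjoint P S := Finset.disjoint_left.mpr fun w hw => ((hmemP w).mp hw).1
  refine ⟨P, (P ∪ S)ᶜ, ?_, ⟨a, (hmemP _).mpr ⟨a.2, .refl⟩⟩, ⟨b, ?_⟩, ?_, ?_⟩
  · exact Finset.disjoint_left.mpr fun w hw h =>
      Finset.mem_compl.mp h (Finset.mem_union_left _ hw)
  · rw [Finset.mem_compl, Finset.mem_union, not_or]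
    exact ⟨fun h => hab ((hmemP _).mp h).2, b.2⟩
  · have h1 := Finset.card_add_card_compl (P ∪ S)
    rw [Finset.card_union_of_disjoint hPS] at h1
    omega
  · intro u v huv
    refine ⟨fun h => hsimple v (h ▸ huv), fun ⟨hu, hv⟩ => ?_⟩
    rw [Finset.mem_compl, Finset.mem_union, not_or] at hv
    obtain ⟨huS, hau⟩ := (hmemP u).mp hu
    exact hv.1 ((hmemP v).mpr ⟨hv.2, hau.tail huv⟩)

theorem exists_not_stronglyConnected_deleteVertices [Fintype V] {G : Digraph V} {k : ℕ}
    (hk : 1 ≤ k) (hkn : k + 2 ≤ Fintype.card V) (hκ : G.vertexConnectivity = k) :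
    ∃ S : Finset V, S.card = k ∧ ¬ (G.deleteVertices S).StronglyConnected := by
  have hne : {c : ℕ | ∃ S : Finset V, S.card = c ∧
      (¬ (G.deleteVertices S).StronglyConnected ∨ Fintype.card V - S.card ≤ 1)}.Nonempty :=
    -- The infimum of the empty set is 0, which k ≥ 1 excludes.
    Nat.nonempty_of_pos_sInf (by rw [vertexConnectivity] at hκ; omega)
  obtain ⟨S, hS, h⟩ := Nat.sInf_mem hne
  rw [vertexConnectivity] at hκ
  rw [hκ] at hS
  -- At least n - k ≥ 2 vertices survive, so strong connectivity must have failed.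
  exact ⟨S, hS, h.resolve_right (by omega)⟩

theorem alphaSpectralRadius_eq_of_isIsomorphic_extremalK [Fintype V] {G : Digraph V} {n k m : ℕ}
    {α : ℝ} (hk : 1 ≤ k) (hm : 1 ≤ m) (hkm : k + m + 1 ≤ n)
    (h : G.IsIsomorphic (extremalK n k m)) (h0 : 0 ≤ α) (h1 : α < 1)
    (hext : m = n - k - 1 ∨ α = 0 ∧ m = 1) :
    G.alphaSpectralRadius α = extremalValue n k α := by
  obtain ⟨P, M, hPM, hP, hM, hn, rfl⟩ := exists_eq_blockDigraph_of_isIsomorphic h (by omega)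
  exact alphaSpectralRadius_blockDigraph hPM (Finset.card_pos.mp (by omega))
    (Finset.card_pos.mp (by omega)) hn (by omega) hk h0 h1
    (hext.imp (fun _ => by omega) fun h => ⟨h.1, by omega⟩)

theorem extremalValue_zero (n k : ℝ) :
    extremalValue n k 0 = (n - 2 + Real.sqrt (n ^ 2 - 4 * n + 4 * k + 4)) / 2 := by
  rw [extremalValue]
  ring_nf

end Digraph

/-! ### The theorem -/

open Digraph in
theorem mainTheorem1 {V : Type*} [Fintype V] (n k : ℕ) (hk : 1 ≤ k) (hkn : k + 2 ≤ n)
    (G : Digraph V) (hcard : Fintype.card V = n) (hsimple : G.IsSimple)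
    (hconn : G.StronglyConnected) (hκ : G.vertexConnectivity = k) :
    (G.alphaSpectralRadius 0 ≤
        ((n : ℝ) - 2 + Real.sqrt ((n : ℝ) ^ 2 - 4 * n + 4 * k + 4)) / 2 ∧
      (G.alphaSpectralRadius 0 =
          ((n : ℝ) - 2 + Real.sqrt ((n : ℝ) ^ 2 - 4 * n + 4 * k + 4)) / 2 ↔
        G.IsIsomorphic (Digraph.extremalK n k (n - k - 1)) ∨
          G.IsIsomorphic (Digraph.extremalK n k 1))) ∧
    (∀ α : ℝ, 0 < α → α < 1 →
      (Digraph.extremalK n k (n - k - 1)).alphaSpectralRadius α =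
          ((n : ℝ) - 2 + α + α * k +
            Real.sqrt ((n : ℝ) ^ 2 + (2 * α - 4 - 2 * α * k) * n + α ^ 2 + α ^ 2 * (k : ℝ) ^ 2
              - 4 * α + 2 * α ^ 2 * k - 4 * α * k + 4 * k + 4)) / 2 ∧
      G.alphaSpectralRadius α ≤
          ((n : ℝ) - 2 + α + α * k +
            Real.sqrt ((n : ℝ) ^ 2 + (2 * α - 4 - 2 * α * k) * n + α ^ 2 + α ^ 2 * (k : ℝ) ^ 2
              - 4 * α + 2 * α ^ 2 * k - 4 * α * k + 4 * k + 4)) / 2 ∧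
      (G.alphaSpectralRadius α =
          ((n : ℝ) - 2 + α + α * k +
            Real.sqrt ((n : ℝ) ^ 2 + (2 * α - 4 - 2 * α * k) * n + α ^ 2 + α ^ 2 * (k : ℝ) ^ 2
              - 4 * α + 2 * α ^ 2 * k - 4 * α * k + 4 * k + 4)) / 2 ↔
        G.IsIsomorphic (Digraph.extremalK n k (n - k - 1)))) := by
  subst hcard
  obtain ⟨S, hS, hS'⟩ := exists_not_stronglyConnected_deleteVertices hk hkn hκ
  obtain ⟨P, M, hPM, hP, hM, hPMk, hG⟩ := exists_blockDigraph_of_not_stronglyConnected hsimple hS'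
  rw [hS] at hPMk
  have hP1 := hP.card_pos
  have hM1 := hM.card_pos
  have bound := fun {α : ℝ} (h0 : 0 ≤ α) (h1 : α < 1) =>
    alphaSpectralRadius_le_extremalValue hconn hG hPM hP hM rfl hPMk hk h0 h1
  have iso : G = blockDigraph P M → ∀ m, M.card = m →
      G.IsIsomorphic (extremalK (Fintype.card V) k m) := fun h m hm =>
    h ▸ blockDigraph_isIsomorphic_extremalK hPM rfl hPMk hm
  refine ⟨?_, fun α h0 h1 => ?_⟩
  · rw [← extremalValue_zero]
    refine ⟨(bound le_rfl one_pos).1, fun h => ?_, fun h => ?_⟩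
    · obtain ⟨hGK, h1 | h1⟩ := (bound le_rfl one_pos).2 h
      -- |P| = 1 means |M| = n - k - 1.
      · exact Or.inl (iso hGK _ (by omega))
      · exact Or.inr (iso hGK _ h1.2)
    · rcases h with h | h
      · exact alphaSpectralRadius_eq_of_isIsomorphic_extremalK hk (by omega) (by omega) h le_rfl
          one_pos (Or.inl rfl)
      · exact alphaSpectralRadius_eq_of_isIsomorphic_extremalK hk le_rfl (by omega) h le_rfl
          one_pos (Or.inr ⟨rfl, rfl⟩)
  · have hm : k + (Fintype.card V - k - 1) + 1 ≤ Fintype.card V := by omega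
    refine ⟨?_, (bound h0.le h1).1, fun h => ?_, fun h => ?_⟩
    -- The extremal digraph is isomorphic to itself, so its value is a case of the same lemma.
    · exact alphaSpectralRadius_eq_of_isIsomorphic_extremalK hk (by omega) hm
        ⟨Equiv.refl _, fun _ _ => Iff.rfl⟩ h0.le h1 (Or.inl rfl)
    · obtain ⟨hGK, h2 | h2⟩ := (bound h0.le h1).2 h
      · exact iso hGK _ (by omega)
      · exact absurd h2.1 h0.ne'
    · exact alphaSpectralRadius_eq_of_isIsomorphic_extremalK hk (by omega) hm h h0.le h1 (Or.inl rfl)
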